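/- Let $-1<q<1$ and let $a,b,c,d$ be real or complex numbers with $|a|,|b|,|c|,|d|<1$. Write $(\alpha)_n=\prod_{j=0}^{n-1}(1-\alpha q^j)$, $(\alpha)_\infty=\prod_{j\ge 0}(1-\alpha q^j)$, $(\alpha_1,\dots,\alpha_k)_\infty=\prod_{i=1}^k(\alpha_i)_\infty$. Let $[m]_q=1+q+\dots+q^{m-1}$, $[m]_q!=\prod_{j=1}^m[j]_q$, and let ${n\brack k}_q=\frac{[n]_q!}{[n-k]_q!\,[k]_q!}$ for $0\le k\le n$ be the $q$-binomial coefficients. Let $h_n(x|q)$ be the continuous $q$-Hermite polynomials, $h_{-1}=0$, $h_0=1$, $h_{n+1}(x|q)=2x\,h_n(x|q)-(1-q^n)h_{n-1}(x|q)$, with generating function $\varphi_h(x|t,q)=\sum_{j\ge 0}\frac{t^j}{(q)_j}h_j(x|q)$ for $|x|\le 1$, $|t|<1$, and let $$f_h(x|q)=\frac{2(q)_\infty\sqrt{1-x^2}}{\pi}\prod_{k=1}^{\infty}\bigl((1+q^k)^2-4q^kx^2\bigr)\qquad(|x|\le 1)$$ be the density of the measure that makes them orthogonal. The Askey–Wilson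 density is, for $|x|\le 1$, $$f_{AW}(x|a,b,c,d,q)=\frac{(ab,ac,ad,bc,bd,cd)_\infty}{(abcd)_\infty}\,f_h(x|q)\,\varphi_h(x|a,q)\,\varphi_h(x|b,q)\,\varphi_h(x|c,q)\,\varphi_h(x|d,q).$$ Put $S^{(2)}_n(b,d|q)=\sum_{j=0}^n{n\brack j}_q b^jd^{n-j}$ and $$\sigma^{(4)}_n(a,b,c,d|q)=\sum_{j=0}^n{n\brack j}_q\frac{(bd)_j}{(abcd)_j}\,S^{(2)}_{n-j}(b,d|q)\sum_{k=0}^j{j\brack k}_q(cb)_k\,a^k\,(ad)_{j-k}\,c^{j-k}.$$ Then for every $x\in[-1,1]$ $$f_{AW}(x|a,b,c,d,q)=f_h(x|q)\sum_{n\ge 0}\frac{\sigma^{(4)}_n(a,b,c,d|q)}{(q)_n}\,h_n(x|q),$$ where the series converges absolutely for every $x\in[-1,1]$ and uniformly on $[-1,1]$. Moreover, for every $n\ge 0$, $\sigma^{(4)}_n(a,b,c,d|q)$ is symmetric in $a,b,c,d$, i.e. invariant under all permutations of the four parameters. -/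

import Mathlib

/-!
The base `q`, the variable `x` and the parameters are taken in a field `𝕜`
that is `ℝ` or `ℂ`; in the theorem `q` and `x` are real.
-/

noncomputable section

namespace AskeyWilson

/-- The finite `q`-Pochhammer symbol `(a; q)_n = ∏_{j=0}^{n-1} (1 - a q^j)`. -/
def qPoch {𝕜 : Type*} [RCLike 𝕜] (q a : 𝕜) (n : ℕ) : 𝕜 :=
  ∏ j ∈ Finset.range n, (1 - a * q ^ j)

/-- The infinite `q`-Pochhammer symbol `(a; q)_∞ = ∏_{j ≥ 0} (1 - a q^j)`. -/
def qPochInf {𝕜 : Type*} [RCLike 𝕜] (q a : 𝕜) : 𝕜 :=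
  ∏' j : ℕ, (1 - a * q ^ j)

/-- The `q`-number `[n]_q = 1 + q + ⋯ + q^{n-1}`. -/
def qNumber {𝕜 : Type*} [RCLike 𝕜] (q : 𝕜) (n : ℕ) : 𝕜 :=
  ∑ i ∈ Finset.range n, q ^ i

/-- The `q`-factorial `[n]_q! = ∏_{j=1}^{n} [j]_q`. -/
def qFactorial {𝕜 : Type*} [RCLike 𝕜] (q : 𝕜) (n : ℕ) : 𝕜 :=
  ∏ j ∈ Finset.Icc 1 n, qNumber q j

/-- The `q`-binomial coefficient, equal to `0` for `k > n`. -/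
def qBinom {𝕜 : Type*} [RCLike 𝕜] (q : 𝕜) (n k : ℕ) : 𝕜 :=
  if k ≤ n then qFactorial q n / (qFactorial q (n - k) * qFactorial q k) else 0

/-- The continuous `q`-Hermite polynomials `h_n(x|q)`:
`h_{-1} = 0`, `h_0 = 1`, `h_{n+1} = 2 x h_n - (1 - q^n) h_{n-1}`. -/
def qHermite {𝕜 : Type*} [RCLike 𝕜] (q x : 𝕜) : ℕ → 𝕜
  | 0 => 1
  | 1 => 2 * x
  | n + 2 => 2 * x * qHermite q x (n + 1) - (1 - q ^ (n + 1)) * qHermite q x n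

/-- The generating function `φ_h(x|t,q) = ∑_{j ≥ 0} t^j h_j(x|q) / (q;q)_j`
(absolutely convergent for `|x| ≤ 1`, `|t| < 1`, `|q| < 1`). -/
def phiH {𝕜 : Type*} [RCLike 𝕜] (q x t : 𝕜) : 𝕜 :=
  ∑' j : ℕ, t ^ j / qPoch q q j * qHermite q x j

/-- The density on `[-1, 1]` that makes the `q`-Hermite polynomials orthogonal:
`f_h(x|q) = (2 (q)_∞ √(1 - x²) / π) ∏_{k ≥ 1} l(x|q^k)`, with
`l(x|a) = (1 + a)² - 4 a x²`. -/
def fH (q x : ℝ) : ℝ :=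
  2 * qPochInf q q * Real.sqrt (1 - x ^ 2) / Real.pi *
    ∏' k : ℕ, ((1 + q ^ (k + 1)) ^ 2 - 4 * q ^ (k + 1) * x ^ 2)

/-- The Askey–Wilson density
`(ab,ac,ad,bc,bd,cd)_∞ / (abcd)_∞ · f_h(x|q) φ_h(x|a,q) φ_h(x|b,q) φ_h(x|c,q) φ_h(x|d,q)`. -/
def fAW {𝕜 : Type*} [RCLike 𝕜] (q x : ℝ) (a b c d : 𝕜) : 𝕜 :=
  qPochInf (q : 𝕜) (a * b) * qPochInf (q : 𝕜) (a * c) * qPochInf (q : 𝕜) (a * d) *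
      qPochInf (q : 𝕜) (b * c) * qPochInf (q : 𝕜) (b * d) * qPochInf (q : 𝕜) (c * d) /
      qPochInf (q : 𝕜) (a * b * c * d) *
    (fH q x : 𝕜) *
    phiH (q : 𝕜) (x : 𝕜) a * phiH (q : 𝕜) (x : 𝕜) b *
    phiH (q : 𝕜) (x : 𝕜) c * phiH (q : 𝕜) (x : 𝕜) d

/-- The symmetric polynomials in two variables
`S_n^{(2)}(b,d|q) = ∑_{j=0}^{n} [n choose j]_q b^j d^{n-j}`. -/
def S2 {𝕜 : Type*} [RCLike 𝕜] (q : 𝕜) (n : ℕ) (b d : 𝕜) : 𝕜 :=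
  ∑ j ∈ Finset.range (n + 1), qBinom q n j * b ^ j * d ^ (n - j)

/-- The coefficients
`σ_n^{(4)}(a,b,c,d|q) = ∑_{j=0}^{n} [n choose j]_q (bd)_j / (abcd)_j · S_{n-j}^{(2)}(b,d|q)
  ∑_{k=0}^{j} [j choose k]_q (cb)_k a^k (ad)_{j-k} c^{j-k}`. -/
def sigma4 {𝕜 : Type*} [RCLike 𝕜] (q : 𝕜) (n : ℕ) (a b c d : 𝕜) : 𝕜 :=
  ∑ j ∈ Finset.range (n + 1),
    qBinom q n j * (qPoch q (b * d) j / qPoch q (a * b * c * d) j) * S2 q (n - j) b d *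
      ∑ k ∈ Finset.range (j + 1),
        qBinom q j k * qPoch q (c * b) k * a ^ k * qPoch q (a * d) (j - k) * c ^ (j - k)

end AskeyWilson

end

/-!
Put `F(a,b,c,d) = ∑ₙ σₙ(a,b,c,d) hₙ(x) / (q)ₙ`. The proof rests on the `q`-difference equation

`(1 - ab)(1 - ac)(1 - ad) F(qa,b,c,d) = (1 - 2xa + a²)(1 - abcd) F(a,b,c,d)`.

By the three-term recurrence of the `hₙ` it follows from a contiguous relation for the
coefficients (`sigma4_contiguous_a`),

`(1 - ab)(1 - ac)(1 - ad) σₙ(qa) = (1 - abcd) ((1 + a²) σₙ - a σₙ₊₁ - a (1 - qⁿ) σₙ₋₁)`,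

which is a finite identity. The inner sums of `σₙ` have the generating function
`(abct, acdt)_∞ / (at, ct)_∞`, hence a three-term recurrence (`innerSum_succ`) and simple dilation
rules in `a` and `b`; these give contiguous relations for the inner sums by induction, and the
formal power series `qGen` carry them over to `σₙ`. The same works for `b ↦ q b`
(`sigma4_contiguous_b`), although `a` and `b` play different roles in the definition of `σₙ`.

Symmetry: for `a ≠ 0` the relation in `a` determines all `σₙ` from `σ₀ = 1`. As `σₙ(b,a,c,d)`
satisfies the same relation, it equals `σₙ(a,b,c,d)`. The exchanges `a ↔ c` and `b ↔ d` are visible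
from the recurrence of the inner sums, and these three transpositions generate all permutations.

Expansion: `φ_h(x|a,q) = F(a,0,0,0)` satisfies the equation with `b = c = d = 0`. Iterating both
equations along `a, qa, q²a, …` and passing to the limit gives (`sigmaSeries_eq_mul_phiH`)

`(abcd)_∞ F(a,b,c,d) = (ab, ac, ad)_∞ F(0,b,c,d) φ_h(x|a,q)`,

and by symmetry the other parameters are split off in the same way. The limit and the uniform
convergence use one majorant `C rⁿ (n + 1)⁴` (`exists_summable_bound`), where `hₙ(x|q)` is
controlled by writing it as `S2` at `e^{iθ}, e^{-iθ}` with `x = cos θ`.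
-/

namespace AskeyWilson

section Algebra

open PowerSeries Finset

variable {𝕜 : Type*} [RCLike 𝕜] {q : 𝕜}

/-! ### Finite Pochhammer symbols and `q`-binomial coefficients -/

@[simp] lemma qPoch_zero (q a : 𝕜) : qPoch q a 0 = 1 := by simp [qPoch]

lemma qPoch_succ (q a : 𝕜) (n : ℕ) : qPoch q a (n + 1) = qPoch q a n * (1 - a * q ^ n) :=
  Finset.prod_range_succ _ _

lemma qPoch_succ' (q a : 𝕜) (n : ℕ) : qPoch q a (n + 1) = (1 - a) * qPoch q (q * a) n := by
  simp only [qPoch, Finset.prod_range_succ']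
  rw [mul_comm, pow_zero, mul_one]
  congr 1
  exact Finset.prod_congr rfl fun j _ => by ring

lemma qPoch_mul_succ (q a : 𝕜) (n : ℕ) :
    qPoch q a n * (1 - a * q ^ n) = (1 - a) * qPoch q (q * a) n := by
  rw [← qPoch_succ, qPoch_succ']

@[simp] lemma qPoch_zero_right (q : 𝕜) (n : ℕ) : qPoch q 0 n = 1 := by simp [qPoch]

lemma one_sub_ne_zero_of_norm_lt {z : 𝕜} (hz : ‖z‖ < 1) : 1 - z ≠ 0 := by
  intro h
  rw [← sub_eq_zero.mp h, norm_one] at hz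
  exact lt_irrefl _ hz

lemma one_sub_mul_pow_ne_zero (hq : ‖q‖ < 1) {a : 𝕜} (ha : ‖a‖ < 1) (n : ℕ) :
    1 - a * q ^ n ≠ 0 := by
  apply one_sub_ne_zero_of_norm_lt
  rw [norm_mul, norm_pow]
  exact (mul_le_of_le_one_right (norm_nonneg _) (pow_le_one₀ (norm_nonneg _) hq.le)).trans_lt ha

lemma qPoch_ne_zero (hq : ‖q‖ < 1) {a : 𝕜} (ha : ‖a‖ < 1) (n : ℕ) : qPoch q a n ≠ 0 :=
  Finset.prod_ne_zero_iff.mpr fun j _ => one_sub_mul_pow_ne_zero hq ha j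

lemma one_sub_pow_succ_ne_zero (hq : ‖q‖ < 1) (n : ℕ) : 1 - q ^ (n + 1) ≠ 0 := by
  rw [pow_succ']
  exact one_sub_mul_pow_ne_zero hq hq n

lemma qPoch_self_succ (q : 𝕜) (n : ℕ) :
    qPoch q q (n + 1) = qPoch q q n * (1 - q ^ (n + 1)) := by
  rw [qPoch_succ, pow_succ']

lemma qFactorial_eq (hq : ‖q‖ < 1) (n : ℕ) : qFactorial q n = qPoch q q n / (1 - q) ^ n := by
  have h1 : 1 - q ≠ 0 := one_sub_ne_zero_of_norm_lt hq
  induction n with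
  | zero => simp [qFactorial]
  | succ n ih =>
    rw [qFactorial, Finset.prod_Icc_succ_top (by omega), ← qFactorial, ih, qPoch_self_succ,
      qNumber, geom_sum_eq (fun h => h1 (by rw [h, sub_self]))]
    rw [← neg_sub 1 (q ^ (n + 1)), ← neg_sub 1 q, neg_div_neg_eq, pow_succ (1 - q)]
    field_simp

lemma qBinom_eq (hq : ‖q‖ < 1) {n k : ℕ} (h : k ≤ n) :
    qBinom q n k = qPoch q q n / (qPoch q q k * qPoch q q (n - k)) := by
  have h1 : 1 - q ≠ 0 := one_sub_ne_zero_of_norm_lt hq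
  have h2 := qPoch_ne_zero hq hq k
  have h3 := qPoch_ne_zero hq hq (n - k)
  rw [qBinom, if_pos h]
  simp only [qFactorial_eq hq]
  have h4 : (1 - q) ^ n = (1 - q) ^ k * (1 - q) ^ (n - k) := by
    rw [← pow_add, Nat.add_sub_cancel' h]
  rw [h4]
  field_simp

/-! ### Generating functions with denominators `(q)_n` -/

/-- The formal power series `∑ wₙ tⁿ / (q)ₙ` attached to a sequence `w`. -/
def qGen (q : 𝕜) (w : ℕ → 𝕜) : PowerSeries 𝕜 := PowerSeries.mk fun n => w n / qPoch q q n

lemma coeff_qGen (q : 𝕜) (w : ℕ → 𝕜) (n : ℕ) :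
    coeff n (qGen q w) = w n / qPoch q q n := coeff_mk _ _

lemma coeff_rescale_qGen (q : 𝕜) (w : ℕ → 𝕜) (n : ℕ) :
    coeff n (rescale q (qGen q w)) = q ^ n * (w n / qPoch q q n) := by
  rw [coeff_rescale, coeff_qGen]

lemma coeff_succ_one_sub_mul (z : 𝕜) (F : PowerSeries 𝕜) (n : ℕ) :
    coeff (n + 1) ((1 - C z * X) * F) = coeff (n + 1) F - z * coeff n F := by
  rw [sub_mul, one_mul, mul_assoc, map_sub, coeff_C_mul, coeff_succ_X_mul]

lemma coeff_zero_one_sub_mul (z : 𝕜) (F : PowerSeries 𝕜) :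
    coeff 0 ((1 - C z * X) * F) = coeff 0 F := by
  rw [sub_mul, one_mul, mul_assoc, map_sub, coeff_C_mul, coeff_zero_X_mul, mul_zero, sub_zero]

/-- Products of the series `qGen` correspond to `q`-binomial convolutions. -/
lemma qGen_mul (hq : ‖q‖ < 1) (w w' : ℕ → 𝕜) :
    qGen q w * qGen q w' =
      qGen q fun n => ∑ k ∈ range (n + 1), qBinom q n k * w k * w' (n - k) := by
  ext n
  rw [coeff_mul, coeff_qGen, Finset.sum_div, Finset.Nat.sum_antidiagonal_eq_sum_range_succ
    (fun i j => coeff i (qGen q w) * coeff j (qGen q w'))]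
  refine Finset.sum_congr rfl fun k hk => ?_
  have hk' : k ≤ n := Nat.lt_succ_iff.mp (Finset.mem_range.mp hk)
  have h1 := qPoch_ne_zero hq hq n
  have h2 := qPoch_ne_zero hq hq k
  have h3 := qPoch_ne_zero hq hq (n - k)
  rw [coeff_qGen, coeff_qGen, qBinom_eq hq hk']
  field_simp

/-- The `q`-binomial theorem, as a `q`-difference equation for `∑ (p)ₙ zⁿ tⁿ / (q)ₙ`. -/
lemma qGen_qPoch_eq (hq : ‖q‖ < 1) (p z : 𝕜) :
    (1 - C z * X) * qGen q (fun n => qPoch q p n * z ^ n) =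
      (1 - C (p * z) * X) * rescale q (qGen q (fun n => qPoch q p n * z ^ n)) := by
  ext n
  cases n with
  | zero => simp only [coeff_zero_one_sub_mul, coeff_rescale_qGen, coeff_qGen]; simp
  | succ n =>
    have h1 := qPoch_ne_zero hq hq n
    have h2 := one_sub_pow_succ_ne_zero hq n
    simp only [coeff_succ_one_sub_mul, coeff_rescale_qGen, coeff_qGen, qPoch_self_succ,
      qPoch_succ]
    field_simp
    ring

lemma qGen_pow_eq (hq : ‖q‖ < 1) (z : 𝕜) :
    (1 - C z * X) * qGen q (fun n => z ^ n) = rescale q (qGen q (fun n => z ^ n)) := by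
  simpa using qGen_qPoch_eq hq 0 z

/-- Replacing `p` by `q p` in `∑ (p)ₙ zⁿ tⁿ / (q)ₙ` divides the series by `1 - p z t`. -/
lemma qGen_qPoch_shift (hq : ‖q‖ < 1) (p z : 𝕜) :
    (1 - C (p * z) * X) * qGen q (fun n => qPoch q (q * p) n * z ^ n) =
      qGen q (fun n => qPoch q p n * z ^ n) := by
  ext n
  cases n with
  | zero => simp only [coeff_zero_one_sub_mul, coeff_qGen]; simp
  | succ n =>
    have h1 := qPoch_ne_zero hq hq n
    have h2 := one_sub_pow_succ_ne_zero hq n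
    have h3 := qPoch_mul_succ q p n
    simp only [coeff_succ_one_sub_mul, coeff_qGen, qPoch_self_succ, qPoch_succ]
    field_simp
    linear_combination (-z ^ (n + 1)) * h3

/-- The same shift of `p`, expressed through the dilation `t ↦ q t`. -/
lemma qGen_qPoch_shift_eq_rescale (hq : ‖q‖ < 1) (p z : 𝕜) :
    (1 - C z * X) * qGen q (fun n => qPoch q (q * p) n * z ^ n) =
      rescale q (qGen q (fun n => qPoch q p n * z ^ n)) := by
  ext n
  cases n with
  | zero => simp only [coeff_zero_one_sub_mul, coeff_rescale_qGen, coeff_qGen]; simp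
  | succ n =>
    have h1 := qPoch_ne_zero hq hq n
    have h2 := one_sub_pow_succ_ne_zero hq n
    have h3 := qPoch_mul_succ q p n
    simp only [coeff_succ_one_sub_mul, coeff_rescale_qGen, coeff_qGen, qPoch_self_succ, qPoch_succ]
    field_simp
    linear_combination (-q ^ (n + 1) * z ^ (n + 1)) * h3

/-- A first order `q`-difference equation with quadratic coefficients is a three-term recurrence.
At `n = 0` the last term vanishes, whatever the value of the truncated `n - 1`. -/
lemma three_term_of_qGen (hq : ‖q‖ < 1) {w : ℕ → 𝕜} {α β γ δ : 𝕜}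
    (h : (1 - C α * X) * ((1 - C β * X) * qGen q w) =
      (1 - C γ * X) * ((1 - C δ * X) * rescale q (qGen q w))) (n : ℕ) :
    w (n + 1) = (α + β - (γ + δ) * q ^ n) * w n -
      (1 - q ^ n) * (α * β - γ * δ * q ^ (n - 1)) * w (n - 1) := by
  have hn := congrArg (coeff (n + 1)) h
  cases n with
  | zero =>
    have h2 := one_sub_pow_succ_ne_zero hq 0
    simp only [coeff_succ_one_sub_mul, coeff_zero_one_sub_mul, coeff_rescale_qGen, coeff_qGen,
      qPoch_self_succ, qPoch_zero] at hn
    field_simp at hn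
    have h3 : (1 - q ^ (0 + 1)) * (w (0 + 1) - (α + β - (γ + δ)) * w 0) = 0 := by
      linear_combination hn
    have := (mul_eq_zero.mp h3).resolve_left h2
    simp only [pow_zero]
    linear_combination this
  | succ n =>
    have h1 := qPoch_ne_zero hq hq n
    have h2 := one_sub_pow_succ_ne_zero hq n
    have h3 := one_sub_pow_succ_ne_zero hq (n + 1)
    simp only [coeff_succ_one_sub_mul, coeff_rescale_qGen, coeff_qGen, qPoch_self_succ] at hn
    rw [Nat.add_sub_cancel]
    have h4 : (1 - q ^ (n + 1 + 1)) * (w (n + 1 + 1) - ((α + β - (γ + δ) * q ^ (n + 1)) * w (n + 1)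
        - (1 - q ^ (n + 1)) * (α * β - γ * δ * q ^ n) * w n)) = 0 := by
      field_simp at hn
      linear_combination hn
    linear_combination (mul_eq_zero.mp h4).resolve_left h3

lemma eq_of_three_term {w w' A B : ℕ → 𝕜} (h0 : w 0 = w' 0) (hB : B 0 = 0)
    (h : ∀ n, w (n + 1) = A n * w n - B n * w (n - 1))
    (h' : ∀ n, w' (n + 1) = A n * w' n - B n * w' (n - 1)) (n : ℕ) : w n = w' n := by
  induction n using Nat.twoStepInduction with
  | zero => exact h0
  | one => rw [h 0, h' 0, h0, hB]
  | more n ih1 ih2 => rw [h (n + 1), h' (n + 1), ih2, Nat.add_sub_cancel, ih1]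

/-! ### The two-parameter polynomials and the inner sums -/

lemma S2_zero (b d : 𝕜) : S2 q 0 b d = 1 := by simp [S2, qBinom, qFactorial]

lemma qGen_S2 (hq : ‖q‖ < 1) (b d : 𝕜) :
    qGen q (fun n => S2 q n b d) = qGen q (fun n => b ^ n) * qGen q (fun n => d ^ n) := by
  rw [qGen_mul hq]; rfl

lemma S2_comm (hq : ‖q‖ < 1) (n : ℕ) (b d : 𝕜) : S2 q n b d = S2 q n d b := by
  have h : qGen q (fun n => S2 q n b d) = qGen q (fun n => S2 q n d b) := by
    rw [qGen_S2 hq, qGen_S2 hq, mul_comm]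
  have hn := congrArg (coeff n) h
  rw [coeff_qGen, coeff_qGen] at hn
  exact (div_left_inj' (qPoch_ne_zero hq hq n)).mp hn

lemma qGen_S2_eq (hq : ‖q‖ < 1) (b d : 𝕜) :
    (1 - C b * X) * ((1 - C d * X) * qGen q (fun n => S2 q n b d)) =
      rescale q (qGen q (fun n => S2 q n b d)) := by
  rw [qGen_S2 hq, map_mul (rescale q), ← qGen_pow_eq hq b, ← qGen_pow_eq hq d]
  ring

lemma S2_succ (hq : ‖q‖ < 1) (b d : 𝕜) (n : ℕ) :
    S2 q (n + 1) b d = (b + d) * S2 q n b d - (1 - q ^ n) * (b * d) * S2 q (n - 1) b d := by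
  have := three_term_of_qGen (w := fun n => S2 q n b d) (γ := 0) (δ := 0) hq
    (by simpa using qGen_S2_eq hq b d) n
  simpa using this

/-- The dilation `b ↦ q b` multiplies the generating function of `S2` by `1 - b t`. -/
lemma qGen_S2_shift (hq : ‖q‖ < 1) (b d : 𝕜) :
    qGen q (fun n => S2 q n (q * b) d) = (1 - C b * X) * qGen q (fun n => S2 q n b d) := by
  have h : qGen q (fun n => (q * b) ^ n) = rescale q (qGen q (fun n => b ^ n)) := by
    ext n
    rw [coeff_rescale_qGen, coeff_qGen, mul_pow, mul_div_assoc]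
  rw [qGen_S2 hq, qGen_S2 hq, h, ← qGen_pow_eq hq b, mul_assoc]

/-- The inner sum `∑ₖ [j choose k]_q (cb)ₖ aᵏ (ad)_{j-k} c^{j-k}` of `sigma4`. -/
def innerSum (q : 𝕜) (j : ℕ) (a b c d : 𝕜) : 𝕜 :=
  ∑ k ∈ range (j + 1),
    qBinom q j k * qPoch q (c * b) k * a ^ k * qPoch q (a * d) (j - k) * c ^ (j - k)

lemma innerSum_zero (a b c d : 𝕜) : innerSum q 0 a b c d = 1 := by
  simp [innerSum, qBinom, qFactorial]

lemma qGen_innerSum (hq : ‖q‖ < 1) (a b c d : 𝕜) :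
    qGen q (fun j => innerSum q j a b c d) =
      qGen q (fun n => qPoch q (c * b) n * a ^ n) * qGen q (fun n => qPoch q (a * d) n * c ^ n) := by
  rw [qGen_mul hq]
  simp only [innerSum, mul_assoc]

/-- The inner sums are, up to normalization, Al-Salam–Chihara polynomials. -/
lemma innerSum_succ (hq : ‖q‖ < 1) (a b c d : 𝕜) (n : ℕ) :
    innerSum q (n + 1) a b c d = (a + c - a * c * (b + d) * q ^ n) * innerSum q n a b c d -
      a * c * ((1 - q ^ n) * (1 - a * b * c * d * q ^ (n - 1))) *
        innerSum q (n - 1) a b c d := by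
  have key : (1 - C a * X) * ((1 - C c * X) * qGen q (fun j => innerSum q j a b c d)) =
      (1 - C (c * b * a) * X) *
        ((1 - C (a * d * c) * X) * rescale q (qGen q (fun j => innerSum q j a b c d))) := by
    rw [qGen_innerSum hq, map_mul (rescale q)]
    linear_combination
      ((1 - C c * X) * qGen q (fun n => qPoch q (a * d) n * c ^ n)) *
        qGen_qPoch_eq hq (c * b) a +
      ((1 - C (c * b * a) * X) * rescale q (qGen q (fun n => qPoch q (c * b) n * a ^ n))) *
        qGen_qPoch_eq hq (a * d) c
  have := three_term_of_qGen hq key n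
  linear_combination this

lemma innerSum_swap_ac (hq : ‖q‖ < 1) (j : ℕ) (a b c d : 𝕜) :
    innerSum q j a b c d = innerSum q j c b a d := by
  refine eq_of_three_term (w := fun n => innerSum q n a b c d)
    (w' := fun n => innerSum q n c b a d) ?_ ?_ (innerSum_succ hq a b c d) (fun n => ?_) j
  · simp only [innerSum_zero]
  · simp
  · have := innerSum_succ hq c b a d n
    linear_combination this

lemma innerSum_swap_bd (hq : ‖q‖ < 1) (j : ℕ) (a b c d : 𝕜) :
    innerSum q j a b c d = innerSum q j a d c b := by
  refine eq_of_three_term (w := fun n => innerSum q n a b c d)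
    (w' := fun n => innerSum q n a d c b) ?_ ?_ (innerSum_succ hq a b c d) (fun n => ?_) j
  · simp only [innerSum_zero]
  · simp
  · have := innerSum_succ hq a d c b n
    linear_combination this

lemma coeff_succ_qGen_one_sub (hq : ‖q‖ < 1) {w w' : ℕ → 𝕜} {z : 𝕜} {n : ℕ}
    (h : coeff (n + 1) ((1 - C z * X) * qGen q w) = w' (n + 1) / qPoch q q (n + 1)) :
    w (n + 1) = z * (1 - q ^ (n + 1)) * w n + w' (n + 1) := by
  have h1 := qPoch_ne_zero hq hq n
  have h2 := one_sub_pow_succ_ne_zero hq n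
  simp only [coeff_succ_one_sub_mul, coeff_qGen, qPoch_self_succ] at h
  field_simp at h
  linear_combination h

lemma innerSum_shift_a (hq : ‖q‖ < 1) (a b c d : 𝕜) (n : ℕ) :
    innerSum q (n + 1) (q * a) b c d =
      c * (1 - q ^ (n + 1)) * innerSum q n (q * a) b c d +
        q ^ (n + 1) * innerSum q (n + 1) a b c d := by
  have h : qGen q (fun n => qPoch q (c * b) n * (q * a) ^ n) =
      rescale q (qGen q (fun n => qPoch q (c * b) n * a ^ n)) := by
    ext n
    rw [coeff_rescale_qGen, coeff_qGen, mul_pow]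
    ring
  have key : (1 - C c * X) * qGen q (fun j => innerSum q j (q * a) b c d) =
      rescale q (qGen q (fun j => innerSum q j a b c d)) := by
    rw [qGen_innerSum hq, qGen_innerSum hq, map_mul (rescale q), h,
      ← qGen_qPoch_shift_eq_rescale hq (a * d) c, mul_assoc q a d]
    ring
  refine coeff_succ_qGen_one_sub (w := fun j => innerSum q j (q * a) b c d)
    (w' := fun j => q ^ j * innerSum q j a b c d) hq ?_
  rw [key, coeff_rescale_qGen, mul_div_assoc]

lemma innerSum_shift_b (hq : ‖q‖ < 1) (a b c d : 𝕜) (n : ℕ) :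
    innerSum q (n + 1) a (q * b) c d =
      c * b * a * (1 - q ^ (n + 1)) * innerSum q n a (q * b) c d +
        innerSum q (n + 1) a b c d := by
  have key : (1 - C (c * b * a) * X) * qGen q (fun j => innerSum q j a (q * b) c d) =
      qGen q (fun j => innerSum q j a b c d) := by
    rw [qGen_innerSum hq, qGen_innerSum hq, ← qGen_qPoch_shift hq (c * b) a,
      mul_left_comm c q b, ← mul_assoc (1 - C (c * b * a) * X)]
  refine coeff_succ_qGen_one_sub (w := fun j => innerSum q j a (q * b) c d)
    (w' := fun j => innerSum q j a b c d) hq ?_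
  rw [key, coeff_qGen]

/-- Contiguous relation for the inner sums under `a ↦ q a`. -/
lemma innerSum_contiguous_a (hq : ‖q‖ < 1) (a b c d : 𝕜) (n : ℕ) :
    (1 - a * b) * (1 - a * c) * (1 - a * d) * innerSum q n (q * a) b c d =
      (1 - a * b * c * d * q ^ n) * (1 + a ^ 2 - a * (b + d) * q ^ n) * innerSum q n a b c d -
      a * (1 - b * d * q ^ n) * innerSum q (n + 1) a b c d -
      a * (1 - a * b * c * d * q ^ n) * ((1 - q ^ n) * (1 - a * b * c * d * q ^ (n - 1))) *
        innerSum q (n - 1) a b c d := by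
  induction n with
  | zero =>
    rw [innerSum_succ hq]
    simp only [innerSum_zero, pow_zero]
    ring
  | succ n ih =>
    have h1 := innerSum_succ hq a b c d (n + 1)
    have h0 := innerSum_succ hq a b c d n
    rw [Nat.add_sub_cancel] at h1 ⊢
    linear_combination (1 - a * b) * (1 - a * c) * (1 - a * d) * innerSum_shift_a hq a b c d n +
      c * (1 - q ^ (n + 1)) * ih + a * (1 - b * d * q ^ (n + 1)) * h1 -
      (1 - q ^ (n + 1)) * (1 - a * b * c * d * q ^ n) * h0

/-- Contiguous relation for the inner sums under `b ↦ q b`. -/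
lemma innerSum_contiguous_b (hq : ‖q‖ < 1) (a b c d : 𝕜) (n : ℕ) :
    (1 - a * b) * (1 - b * c) * innerSum q n a (q * b) c d =
      (1 - a * b * c * d * q ^ n) * innerSum q n a b c d - b * innerSum q (n + 1) a b c d := by
  induction n with
  | zero =>
    rw [innerSum_succ hq]
    simp only [innerSum_zero, pow_zero]
    ring
  | succ n ih =>
    have h1 := innerSum_succ hq a b c d (n + 1)
    rw [Nat.add_sub_cancel] at h1
    linear_combination (1 - a * b) * (1 - b * c) * innerSum_shift_b hq a b c d n +
      c * b * a * (1 - q ^ (n + 1)) * ih + b * h1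

end Algebra

section Contiguous

open PowerSeries Finset

variable {𝕜 : Type*} [RCLike 𝕜] {q : 𝕜}

/-! ### Contiguous relations for the coefficients -/

/-- The factor `(bd)_j / (abcd)_j ∑ₖ ⋯` of `sigma4`, so that `sigma4` is the `q`-binomial
convolution of `weightedSum` and `S2`. -/
def weightedSum (q : 𝕜) (j : ℕ) (a b c d : 𝕜) : 𝕜 :=
  qPoch q (b * d) j / qPoch q (a * b * c * d) j * innerSum q j a b c d

lemma qGen_sigma4 (hq : ‖q‖ < 1) (a b c d : 𝕜) :
    qGen q (fun n => sigma4 q n a b c d) =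
      qGen q (fun n => weightedSum q n a b c d) * qGen q (fun n => S2 q n b d) := by
  rw [qGen_mul hq]
  congr 1
  funext n
  refine Finset.sum_congr rfl fun k _ => ?_
  rw [weightedSum, innerSum]
  ring

lemma norm_mul_lt_one {x y : 𝕜} (hx : ‖x‖ < 1) (hy : ‖y‖ < 1) : ‖x * y‖ < 1 := by
  rw [norm_mul]
  exact mul_lt_one_of_nonneg_of_lt_one_left (norm_nonneg _) hx hy.le

lemma norm_mul4_lt_one {a b c d : 𝕜} (ha : ‖a‖ < 1) (hb : ‖b‖ < 1) (hc : ‖c‖ < 1)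
    (hd : ‖d‖ < 1) : ‖a * b * c * d‖ < 1 :=
  norm_mul_lt_one (norm_mul_lt_one (norm_mul_lt_one ha hb) hc) hd

lemma weightedSum_contiguous_a (hq : ‖q‖ < 1) {a b c d : 𝕜} (he : ‖a * b * c * d‖ < 1) (n : ℕ) :
    (1 - a * b) * (1 - a * c) * (1 - a * d) * weightedSum q n (q * a) b c d =
      (1 - a * b * c * d) * ((1 + a ^ 2 - a * (b + d) * q ^ n) * weightedSum q n a b c d -
        a * weightedSum q (n + 1) a b c d -
        a * ((1 - q ^ n) * (1 - b * d * q ^ (n - 1)) * weightedSum q (n - 1) a b c d)) := by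
  have hU := innerSum_contiguous_a hq a b c d n
  have h1 := one_sub_ne_zero_of_norm_lt he
  have h3 := one_sub_mul_pow_ne_zero hq he n
  have h4 : qPoch q (q * a * b * c * d) n =
      qPoch q (a * b * c * d) n * (1 - a * b * c * d * q ^ n) / (1 - a * b * c * d) := by
    rw [eq_div_iff h1, qPoch_mul_succ]
    simp only [mul_assoc]
    ring
  simp only [weightedSum, h4]
  generalize innerSum q n (q * a) b c d = U at hU ⊢
  cases n with
  | zero =>
    simp only [pow_zero, sub_self, zero_mul, mul_zero, sub_zero, qPoch_succ, qPoch_zero,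
      mul_one, one_mul] at hU h3 ⊢
    field_simp
    linear_combination hU
  | succ n =>
    have h5 := one_sub_mul_pow_ne_zero hq he n
    have h2 := qPoch_ne_zero hq he n
    simp only [Nat.add_sub_cancel] at hU ⊢
    simp only [qPoch_succ]
    field_simp
    linear_combination (1 - b * d * q ^ n) * qPoch q (b * d) n * hU

lemma weightedSum_contiguous_b (hq : ‖q‖ < 1) {a b c d : 𝕜} (he : ‖a * b * c * d‖ < 1) (n : ℕ) :
    (1 - b * a) * (1 - b * c) * (1 - b * d) * weightedSum q n a (q * b) c d =
      (1 - a * b * c * d) * ((1 - b * d * q ^ n) * weightedSum q n a b c d -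
        b * weightedSum q (n + 1) a b c d) := by
  have hU := innerSum_contiguous_b hq a b c d n
  have h1 := one_sub_ne_zero_of_norm_lt he
  have h2 := qPoch_ne_zero hq he n
  have h3 := one_sub_mul_pow_ne_zero hq he n
  have h4 : qPoch q (a * (q * b) * c * d) n =
      qPoch q (a * b * c * d) n * (1 - a * b * c * d * q ^ n) / (1 - a * b * c * d) := by
    rw [eq_div_iff h1, qPoch_mul_succ, show a * (q * b) * c * d = q * (a * b * c * d) by ring]
    ring
  have h5 : qPoch q (b * d) n * (1 - b * d * q ^ n) = (1 - b * d) * qPoch q (q * b * d) n := by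
    rw [qPoch_mul_succ, mul_assoc q b d]
  simp only [weightedSum, h4, qPoch_succ]
  generalize innerSum q n a (q * b) c d = U at hU ⊢
  generalize qPoch q (q * b * d) n = R at h5 ⊢
  generalize a * b * c * d = e at h1 h2 h3 hU ⊢
  field_simp
  linear_combination (1 - b * d * q ^ n) * qPoch q (b * d) n * hU -
    (1 - b * a) * (1 - b * c) * U * h5

/-- A contiguous relation between sequences `v` and `v'` is a functional equation between their
generating functions. -/
lemma contiguous_iff_qGen (hq : ‖q‖ < 1) (v v' : ℕ → 𝕜) (κ e a γ δ : 𝕜) :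
    (∀ n, κ * v' n = e * ((1 + a ^ 2 - a * (γ + δ) * q ^ n) * v n - a * v (n + 1) -
        a * ((1 - q ^ n) * (1 - γ * δ * q ^ (n - 1)) * v (n - 1)))) ↔
      C κ * (X * qGen q v') =
        C e * ((1 - C a * X) * (X * qGen q v) - C a * ((1 - C a * X) * qGen q v) +
          C a * ((1 - C γ * X) * ((1 - C δ * X) * rescale q (qGen q v)))) := by
  rw [PowerSeries.ext_iff]
  have h0 : ∀ n, 1 - q ^ (n + 1) ≠ 0 := one_sub_pow_succ_ne_zero hq
  have hP : ∀ n, qPoch q q n ≠ 0 := qPoch_ne_zero hq hq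
  have key : ∀ n, (κ * v' n = e * ((1 + a ^ 2 - a * (γ + δ) * q ^ n) * v n - a * v (n + 1) -
        a * ((1 - q ^ n) * (1 - γ * δ * q ^ (n - 1)) * v (n - 1)))) ↔
      coeff (n + 1) (C κ * (X * qGen q v')) = coeff (n + 1)
        (C e * ((1 - C a * X) * (X * qGen q v) - C a * ((1 - C a * X) * qGen q v) +
          C a * ((1 - C γ * X) * ((1 - C δ * X) * rescale q (qGen q v))))) := by
    intro n
    cases n with
    | zero =>
      have h1 := h0 0
      simp only [coeff_C_mul, map_add, map_sub, coeff_succ_X_mul, coeff_zero_X_mul,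
        coeff_succ_one_sub_mul, coeff_zero_one_sub_mul, coeff_rescale_qGen, coeff_qGen,
        qPoch_self_succ, qPoch_zero]
      field_simp
      constructor
      · intro h
        linear_combination (1 - q ^ (0 + 1)) * h
      · intro h
        apply mul_left_cancel₀ h1
        linear_combination h
    | succ n =>
      have h1 := h0 n
      have h2 := h0 (n + 1)
      have h3 := hP n
      simp only [coeff_C_mul, map_add, map_sub, coeff_succ_X_mul,
        coeff_succ_one_sub_mul, coeff_rescale_qGen, coeff_qGen,
        qPoch_self_succ, Nat.add_sub_cancel]
      field_simp
      constructor
      · intro h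
        linear_combination (1 - q ^ (n + 1 + 1)) * h
      · intro h
        apply mul_left_cancel₀ h2
        linear_combination h
  constructor
  · intro h n
    cases n with
    | zero =>
      simp only [coeff_C_mul, map_add, map_sub, coeff_zero_X_mul,
        coeff_zero_one_sub_mul, coeff_rescale_qGen, coeff_qGen]
      ring
    | succ n => exact (key n).mp (h n)
  · exact fun h n => (key n).mpr (h (n + 1))

/-- The effect of `a ↦ q a` on the coefficients; multiplied by `hₙ/(q)ₙ` and summed, it becomes
a `q`-difference equation in `a` for the series `∑ σₙ hₙ / (q)ₙ`. -/
lemma sigma4_contiguous_a (hq : ‖q‖ < 1) {a b c d : 𝕜} (he : ‖a * b * c * d‖ < 1) (n : ℕ) :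
    (1 - a * b) * (1 - a * c) * (1 - a * d) * sigma4 q n (q * a) b c d =
      (1 - a * b * c * d) * ((1 + a ^ 2) * sigma4 q n a b c d - a * sigma4 q (n + 1) a b c d -
        a * ((1 - q ^ n) * sigma4 q (n - 1) a b c d)) := by
  have hV := (contiguous_iff_qGen hq (fun n => weightedSum q n a b c d)
    (fun n => weightedSum q n (q * a) b c d) _ _ _ _ _).mp (weightedSum_contiguous_a hq he)
  have hG := (contiguous_iff_qGen hq (fun n => sigma4 q n a b c d)
    (fun n => sigma4 q n (q * a) b c d) ((1 - a * b) * (1 - a * c) * (1 - a * d))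
    (1 - a * b * c * d) a 0 0).mpr ?_ n
  · simpa using hG
  · rw [qGen_sigma4 hq, qGen_sigma4 hq, map_mul (rescale q), ← qGen_S2_eq hq]
    simp only [map_zero, zero_mul, sub_zero, one_mul]
    linear_combination qGen q (fun n => S2 q n b d) * hV

/-- The counterpart of `sigma4_contiguous_a` for `b ↦ q b`. -/
lemma sigma4_contiguous_b (hq : ‖q‖ < 1) {a b c d : 𝕜} (he : ‖a * b * c * d‖ < 1) (n : ℕ) :
    (1 - b * a) * (1 - b * c) * (1 - b * d) * sigma4 q n a (q * b) c d =
      (1 - a * b * c * d) * ((1 + b ^ 2) * sigma4 q n a b c d - b * sigma4 q (n + 1) a b c d -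
        b * ((1 - q ^ n) * sigma4 q (n - 1) a b c d)) := by
  have hV : C ((1 - b * a) * (1 - b * c) * (1 - b * d)) *
      (X * qGen q (fun n => weightedSum q n a (q * b) c d)) = C (1 - a * b * c * d) *
      (X * qGen q (fun n => weightedSum q n a b c d) -
        C b * qGen q (fun n => weightedSum q n a b c d) +
        C b * ((1 - C d * X) * rescale q (qGen q (fun n => weightedSum q n a b c d)))) := by
    have h3 := weightedSum_contiguous_b hq he
    generalize 1 - a * b * c * d = e at h3 ⊢
    generalize (1 - b * a) * (1 - b * c) * (1 - b * d) = κ at h3 ⊢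
    ext n
    cases n with
    | zero =>
      simp only [coeff_C_mul, map_add, map_sub, coeff_zero_X_mul,
        coeff_zero_one_sub_mul, coeff_rescale_qGen, coeff_qGen]
      ring
    | succ n =>
      have h1 := one_sub_pow_succ_ne_zero hq n
      have h2 := qPoch_ne_zero hq hq n
      have h4 := h3 n
      simp only [coeff_C_mul, map_add, map_sub, coeff_succ_X_mul,
        coeff_succ_one_sub_mul, coeff_rescale_qGen, coeff_qGen, qPoch_self_succ]
      generalize weightedSum q n a (q * b) c d = V at h4 ⊢
      field_simp
      linear_combination (1 - q ^ (n + 1)) * h4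
  have hG := (contiguous_iff_qGen hq (fun n => sigma4 q n a b c d)
    (fun n => sigma4 q n a (q * b) c d) ((1 - b * a) * (1 - b * c) * (1 - b * d))
    (1 - a * b * c * d) b 0 0).mpr ?_ n
  · simpa using hG
  · rw [qGen_sigma4 hq, qGen_sigma4 hq, qGen_S2_shift hq, map_mul (rescale q), ← qGen_S2_eq hq]
    simp only [map_zero, zero_mul, sub_zero, one_mul]
    linear_combination ((1 - C b * X) * qGen q (fun n => S2 q n b d)) * hV

/-! ### Symmetry of the coefficients -/

lemma sigma4_zero (a b c d : 𝕜) : sigma4 q 0 a b c d = 1 := by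
  simp [sigma4, S2_zero, qBinom, qFactorial]

lemma sigma4_swap_ac (hq : ‖q‖ < 1) (n : ℕ) (a b c d : 𝕜) :
    sigma4 q n a b c d = sigma4 q n c b a d := by
  refine Finset.sum_congr rfl fun j _ => ?_
  have h := innerSum_swap_ac hq j a b c d
  rw [innerSum, innerSum] at h
  rw [h, show a * b * c * d = c * b * a * d by ring]

lemma sigma4_swap_bd (hq : ‖q‖ < 1) (n : ℕ) (a b c d : 𝕜) :
    sigma4 q n a b c d = sigma4 q n a d c b := by
  refine Finset.sum_congr rfl fun j _ => ?_
  have h := innerSum_swap_bd hq j a b c d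
  rw [innerSum, innerSum] at h
  rw [h, S2_comm hq, show a * b * c * d = a * d * c * b by ring, mul_comm b d]

/-- For `a ≠ 0` the contiguous relation in `a` determines `σₙ₊₁` from earlier terms, and by
`sigma4_contiguous_b` it also holds after exchanging `a` and `b`. -/
lemma sigma4_swap_ab (hq : ‖q‖ < 1) {c d : 𝕜} (hc : ‖c‖ < 1) (hd : ‖d‖ < 1) (n : ℕ) :
    ∀ a b : 𝕜, ‖a‖ < 1 → ‖b‖ < 1 → sigma4 q n a b c d = sigma4 q n b a c d := by
  induction n using Nat.strong_induction_on with
  | _ n ih =>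
  cases n with
  | zero => intros; rw [sigma4_zero, sigma4_zero]
  | succ n =>
    have key : ∀ a b : 𝕜, a ≠ 0 → ‖a‖ < 1 → ‖b‖ < 1 →
        sigma4 q (n + 1) a b c d = sigma4 q (n + 1) b a c d := by
      intro a b h0 ha hb
      have he := norm_mul4_lt_one ha hb hc hd
      have he' := norm_mul4_lt_one hb ha hc hd
      have h1 := sigma4_contiguous_a hq he n
      have h2 := sigma4_contiguous_b hq he' n
      rw [ih n (by omega) (q * a) b (norm_mul_lt_one hq ha) hb, ih n (by omega) a b ha hb,
        ih (n - 1) (by omega) a b ha hb] at h1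
      have h3 : (1 - a * b * c * d) * a ≠ 0 := mul_ne_zero (one_sub_ne_zero_of_norm_lt he) h0
      apply mul_left_cancel₀ h3
      linear_combination h1 - h2
    intro a b ha hb
    by_cases h0 : a = 0
    · by_cases h0' : b = 0
      · rw [h0, h0']
      · exact (key b a h0' hb ha).symm
    · exact key a b h0 ha hb

lemma sigma4_perm (hq : ‖q‖ < 1) (n : ℕ) (τ : Equiv.Perm (Fin 4)) :
    ∀ v : Fin 4 → 𝕜, (∀ i, ‖v i‖ < 1) →
      sigma4 q n (v (τ 0)) (v (τ 1)) (v (τ 2)) (v (τ 3)) =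
        sigma4 q n (v 0) (v 1) (v 2) (v 3) := by
  have hab : ∀ a b c d : 𝕜, ‖a‖ < 1 → ‖b‖ < 1 → ‖c‖ < 1 → ‖d‖ < 1 →
      sigma4 q n a b c d = sigma4 q n b a c d := fun a b c d ha hb hc hd =>
    sigma4_swap_ab hq hc hd n a b ha hb
  have hac := sigma4_swap_ac hq n
  have hbd := sigma4_swap_bd hq n
  have hbc : ∀ a b c d : 𝕜, ‖a‖ < 1 → ‖b‖ < 1 → ‖c‖ < 1 → ‖d‖ < 1 →
      sigma4 q n a b c d = sigma4 q n a c b d := fun a b c d ha hb hc hd => by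
    rw [hab a b c d ha hb hc hd, hac b a c d, hab c a b d hc ha hb hd]
  have hcd : ∀ a b c d : 𝕜, ‖a‖ < 1 → ‖b‖ < 1 → ‖c‖ < 1 → ‖d‖ < 1 →
      sigma4 q n a b c d = sigma4 q n a b d c := fun a b c d ha hb hc hd => by
    rw [hbc a b c d ha hb hc hd, hbd a c b d, hbc a d b c ha hd hb hc]
  have hmem : τ ∈ Submonoid.closure
      (Set.range fun i : Fin 3 => Equiv.swap i.castSucc i.succ) := by
    rw [Equiv.Perm.mclosure_swap_castSucc_succ]
    trivial
  induction hmem using Submonoid.closure_induction with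
  | mem τ h =>
    obtain ⟨i, rfl⟩ := h
    intro v hv
    fin_cases i
    · exact hab _ _ _ _ (hv _) (hv _) (hv _) (hv _)
    · exact hbc _ _ _ _ (hv _) (hv _) (hv _) (hv _)
    · exact hcd _ _ _ _ (hv _) (hv _) (hv _) (hv _)
  | one => intro v _; rfl
  | mul σ τ _ _ h1 h2 =>
    intro v hv
    exact (h2 (fun i => v (σ i)) fun i => hv _).trans (h1 v hv)

end Contiguous

section Bounds

open Finset

variable {𝕜 : Type*} [RCLike 𝕜] {q : 𝕜}

/-! ### Uniform bounds -/

lemma prod_one_add_mul_pow_le (hq : ‖q‖ < 1) {s : ℝ} (hs : 0 ≤ s) (n : ℕ) :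
    ∏ j ∈ range n, (1 + s * ‖q‖ ^ j) ≤ Real.exp (s * (1 - ‖q‖)⁻¹) := by
  calc ∏ j ∈ range n, (1 + s * ‖q‖ ^ j) ≤ ∏ j ∈ range n, Real.exp (s * ‖q‖ ^ j) := by
        refine Finset.prod_le_prod (fun j _ => by positivity) fun j _ => ?_
        rw [add_comm]
        exact Real.add_one_le_exp _
    _ = Real.exp (s * ∑ j ∈ range n, ‖q‖ ^ j) := by rw [← Real.exp_sum, Finset.mul_sum]
    _ ≤ Real.exp (s * (1 - ‖q‖)⁻¹) := by
        rw [Real.exp_le_exp, ← tsum_geometric_of_lt_one (norm_nonneg q) hq]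
        exact mul_le_mul_of_nonneg_left
          ((summable_geometric_of_lt_one (norm_nonneg q) hq).sum_le_tsum _
            fun _ _ => by positivity) hs

lemma exists_norm_qPoch_le (hq : ‖q‖ < 1) :
    ∃ M : ℝ, 0 < M ∧ ∀ a : 𝕜, ‖a‖ ≤ 1 → ∀ n, ‖qPoch q a n‖ ≤ M := by
  refine ⟨_, Real.exp_pos _, fun a ha n =>
    le_trans ?_ (prod_one_add_mul_pow_le hq zero_le_one n)⟩
  rw [qPoch, norm_prod]
  refine Finset.prod_le_prod (fun j _ => norm_nonneg _) fun j _ => ?_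
  refine (norm_sub_le _ _).trans ?_
  rw [norm_one, norm_mul, norm_pow]
  gcongr

lemma exists_norm_inv_qPoch_le (hq : ‖q‖ < 1) {r : ℝ} (hr0 : 0 ≤ r) (hr : r < 1) :
    ∃ M : ℝ, 0 < M ∧ ∀ a : 𝕜, ‖a‖ ≤ r → ∀ n, ‖(qPoch q a n)⁻¹‖ ≤ M := by
  have hr' : 0 < 1 - r := by linarith
  refine ⟨_, Real.exp_pos _, fun a ha n =>
    le_trans ?_ (prod_one_add_mul_pow_le hq (s := (1 - r)⁻¹) (by positivity) n)⟩
  rw [qPoch, norm_inv, norm_prod, ← Finset.prod_inv_distrib]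
  refine Finset.prod_le_prod (fun j _ => by positivity) fun j _ => ?_
  have hy0 : 0 ≤ ‖q‖ ^ j := by positivity
  have hy1 : ‖q‖ ^ j ≤ 1 := pow_le_one₀ (norm_nonneg _) hq.le
  have h1 : 1 - r * ‖q‖ ^ j ≤ ‖1 - a * q ^ j‖ := by
    have := norm_sub_norm_le (1 : 𝕜) (a * q ^ j)
    rw [norm_one, norm_mul, norm_pow] at this
    have h2 : ‖a‖ * ‖q‖ ^ j ≤ r * ‖q‖ ^ j := by gcongr
    linarith
  generalize ‖q‖ ^ j = y at *
  have h2 : 0 < 1 - r * y := by nlinarith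
  refine (inv_anti₀ h2 h1).trans ?_
  -- `(1 - r y) (1 + y / (1 - r)) ≥ 1` because `y ≤ 1`
  rw [inv_le_iff_one_le_mul₀ h2]
  have h3 : (1 - r)⁻¹ * (1 - r) = 1 := inv_mul_cancel₀ hr'.ne'
  have h4 : 0 ≤ (1 - r)⁻¹ := by positivity
  have h5 : 0 ≤ (1 - r)⁻¹ * (r * y * (1 - y)) :=
    mul_nonneg h4 (mul_nonneg (mul_nonneg hr0 hy0) (by linarith))
  have h6 : 0 ≤ y * (1 - r) := mul_nonneg hy0 hr'.le
  have h7 : (1 + (1 - r)⁻¹ * y) * (1 - r * y) =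
      1 + y * (1 - r) + (1 - r)⁻¹ * (r * y * (1 - y)) := by
    linear_combination y * h3
  rw [h7]
  linarith

lemma exists_norm_qBinom_le (hq : ‖q‖ < 1) :
    ∃ M : ℝ, 0 < M ∧ ∀ n k, ‖qBinom q n k‖ ≤ M := by
  obtain ⟨A, hA, hA'⟩ := exists_norm_qPoch_le hq
  obtain ⟨B, hB, hB'⟩ := exists_norm_inv_qPoch_le hq (norm_nonneg q) hq
  refine ⟨A * (B * B), by positivity, fun n k => ?_⟩
  by_cases h : k ≤ n
  · rw [qBinom_eq hq h, div_eq_mul_inv, mul_inv, norm_mul, norm_mul]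
    gcongr
    · exact hA' q hq.le n
    · exact hB' q le_rfl k
    · exact hB' q le_rfl (n - k)
  · rw [qBinom, if_neg h, norm_zero]
    positivity

lemma norm_sum_range_succ_le {f : ℕ → 𝕜} {n : ℕ} {B : ℝ} (h : ∀ j ≤ n, ‖f j‖ ≤ B) :
    ‖∑ j ∈ range (n + 1), f j‖ ≤ B * (n + 1) := by
  refine (norm_sum_le_of_le _ fun j hj => h j (Nat.lt_succ_iff.mp (Finset.mem_range.mp hj))).trans ?_
  rw [Finset.sum_const, Finset.card_range, nsmul_eq_mul]
  push_cast
  exact (mul_comm _ _).le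

lemma exists_norm_S2_le (hq : ‖q‖ < 1) :
    ∃ M : ℝ, 0 < M ∧ ∀ (r : ℝ) (b d : 𝕜), ‖b‖ ≤ r → ‖d‖ ≤ r →
      ∀ n : ℕ, ‖S2 q n b d‖ ≤ M * r ^ n * (n + 1) := by
  obtain ⟨M, hM, hM'⟩ := exists_norm_qBinom_le hq
  refine ⟨M, hM, fun r b d hb hd n => norm_sum_range_succ_le fun j hj => ?_⟩
  have hr : 0 ≤ r := (norm_nonneg _).trans hb
  rw [norm_mul, norm_mul, norm_pow, norm_pow, ← Nat.add_sub_cancel' hj, pow_add, ← mul_assoc,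
    Nat.add_sub_cancel_left]
  gcongr
  exact hM' _ _

lemma exists_norm_innerSum_le (hq : ‖q‖ < 1) :
    ∃ M : ℝ, 0 < M ∧ ∀ (r : ℝ) (a b c d : 𝕜), r ≤ 1 → ‖a‖ ≤ r → ‖b‖ ≤ r → ‖c‖ ≤ r → ‖d‖ ≤ r →
      ∀ n : ℕ, ‖innerSum q n a b c d‖ ≤ M * r ^ n * (n + 1) := by
  obtain ⟨M, hM, hM'⟩ := exists_norm_qBinom_le hq
  obtain ⟨A, hA, hA'⟩ := exists_norm_qPoch_le hq
  refine ⟨M * A * A, by positivity, fun r a b c d hr1 ha hb hc hd n =>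
    norm_sum_range_succ_le fun j hj => ?_⟩
  have hr : 0 ≤ r := (norm_nonneg _).trans ha
  have h1 : ‖c * b‖ ≤ 1 := by
    rw [norm_mul]; exact mul_le_one₀ (hc.trans hr1) (norm_nonneg _) (hb.trans hr1)
  have h2 : ‖a * d‖ ≤ 1 := by
    rw [norm_mul]; exact mul_le_one₀ (ha.trans hr1) (norm_nonneg _) (hd.trans hr1)
  rw [norm_mul, norm_mul, norm_mul, norm_mul, norm_pow, norm_pow]
  calc ‖qBinom q n j‖ * ‖qPoch q (c * b) j‖ * ‖a‖ ^ j * ‖qPoch q (a * d) (n - j)‖ *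
        ‖c‖ ^ (n - j) ≤ M * A * r ^ j * A * r ^ (n - j) := by
        gcongr
        · exact hM' _ _
        · exact hA' _ h1 _
        · exact hA' _ h2 _
    _ = M * A * A * r ^ n := by
        rw [show r ^ n = r ^ j * r ^ (n - j) by rw [← pow_add, Nat.add_sub_cancel' hj]]
        ring

/-- Geometric decay of the coefficients, uniform on polydiscs of radius `r < 1`. -/
lemma exists_norm_sigma4_div_le (hq : ‖q‖ < 1) {r : ℝ} (hr0 : 0 ≤ r) (hr : r < 1) :
    ∃ M : ℝ, 0 < M ∧ ∀ a b c d : 𝕜, ‖a‖ ≤ r → ‖b‖ ≤ r → ‖c‖ ≤ r → ‖d‖ ≤ r →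
      ∀ n : ℕ, ‖sigma4 q n a b c d / qPoch q q n‖ ≤ M * r ^ n * ((n : ℝ) + 1) ^ 3 := by
  obtain ⟨M, hM, hM'⟩ := exists_norm_qBinom_le hq
  obtain ⟨A, hA, hA'⟩ := exists_norm_qPoch_le hq
  obtain ⟨B, hB, hB'⟩ := exists_norm_inv_qPoch_le hq hr0 hr
  obtain ⟨D, hD, hD'⟩ := exists_norm_inv_qPoch_le hq (norm_nonneg q) hq
  obtain ⟨S, hS, hS'⟩ := exists_norm_S2_le hq
  obtain ⟨U, hU, hU'⟩ := exists_norm_innerSum_le hq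
  refine ⟨M * A * B * S * U * D, by positivity, fun a b c d ha hb hc hd n => ?_⟩
  have hbd : ‖b * d‖ ≤ 1 := by
    rw [norm_mul]; exact mul_le_one₀ (hb.trans hr.le) (norm_nonneg _) (hd.trans hr.le)
  have he : ‖a * b * c * d‖ ≤ r := by
    rw [show a * b * c * d = a * c * (b * d) by ring, norm_mul, norm_mul]
    calc ‖a‖ * ‖c‖ * ‖b * d‖ ≤ r * 1 * 1 := by
          gcongr
          exact hc.trans hr.le
      _ = r := by ring
  have key : ‖sigma4 q n a b c d‖ ≤
      M * A * B * S * U * r ^ n * ((n : ℝ) + 1) ^ 2 * (n + 1) := by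
    refine norm_sum_range_succ_le fun j hj => ?_
    have hj' : (j : ℝ) ≤ n := by exact_mod_cast hj
    have hnj : ((n - j : ℕ) : ℝ) ≤ n := by exact_mod_cast Nat.sub_le n j
    have h1 := hS' r b d hb hd (n - j)
    have h2 := hU' r a b c d hr.le ha hb hc hd j
    rw [innerSum] at h2
    rw [norm_mul, norm_mul, norm_mul, div_eq_mul_inv, norm_mul]
    calc _ ≤ M * (A * B) * (S * r ^ (n - j) * ((n : ℝ) + 1)) * (U * r ^ j * ((n : ℝ) + 1)) := by
          gcongr
          · exact hM' _ _
          · exact hA' _ hbd _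
          · exact hB' _ he _
          · exact h1.trans (by gcongr)
          · exact h2.trans (by gcongr)
      _ = M * A * B * S * U * r ^ n * ((n : ℝ) + 1) ^ 2 := by
          rw [show r ^ n = r ^ j * r ^ (n - j) by rw [← pow_add, Nat.add_sub_cancel' hj]]
          ring
  rw [div_eq_mul_inv, norm_mul]
  calc _ ≤ M * A * B * S * U * r ^ n * ((n : ℝ) + 1) ^ 2 * (n + 1) * D := by
        gcongr
        exact hD' q le_rfl n
    _ = _ := by ring

lemma qHermite_succ (q x : 𝕜) (n : ℕ) :
    qHermite q x (n + 1) = 2 * x * qHermite q x n - (1 - q ^ n) * qHermite q x (n - 1) := by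
  cases n with
  | zero => simp [qHermite]
  | succ n => rw [qHermite, Nat.add_sub_cancel]

/-- With `x = (z + z⁻¹) / 2` one has `hₙ(x|q) = ∑ₖ [n choose k]_q z^{2k-n}`. -/
lemma qHermite_eq_S2 (hq : ‖q‖ < 1) {x z w : 𝕜} (h : z + w = 2 * x) (h' : z * w = 1) (n : ℕ) :
    qHermite q x n = S2 q n z w := by
  refine eq_of_three_term (w := qHermite q x) (w' := fun n => S2 q n z w) (A := fun _ => 2 * x)
    (B := fun n => 1 - q ^ n) ?_ (by simp) (qHermite_succ q x) (fun n => ?_) n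
  · rw [S2_zero, qHermite]
  · have := S2_succ hq z w n
    rw [h, h', mul_one] at this
    exact this

lemma qHermite_ofReal (q x : ℝ) (n : ℕ) :
    qHermite (q : 𝕜) (x : 𝕜) n = ((qHermite q x n : ℝ) : 𝕜) := by
  induction n using Nat.twoStepInduction with
  | zero => simp [qHermite]
  | one =>
    rw [qHermite, qHermite]
    push_cast
    rfl
  | more n h1 h2 =>
    rw [qHermite, qHermite, h1, h2]
    push_cast
    ring

end Bounds

section Series

open Finset Filter Topology

variable {𝕜 : Type*} [RCLike 𝕜] {q : ℝ}

lemma norm_ofReal_lt_one (hq : |q| < 1) : ‖(q : 𝕜)‖ < 1 := by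
  rwa [RCLike.norm_ofReal]

/-- On `[-1, 1]` write `x = cos θ`; then `hₙ(x|q)` is a sum of `n + 1` bounded terms. -/
lemma exists_norm_qHermite_le (𝕜 : Type*) [RCLike 𝕜] (hq : |q| < 1) :
    ∃ M : ℝ, 0 < M ∧ ∀ x : ℝ, |x| ≤ 1 → ∀ n : ℕ,
      ‖qHermite (q : 𝕜) (x : 𝕜) n‖ ≤ M * (n + 1) := by
  obtain ⟨M, hM, hM'⟩ := exists_norm_S2_le (q := (q : ℂ)) (by simpa using hq)
  refine ⟨M, hM, fun x hx n => ?_⟩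
  have hx2 : 0 ≤ 1 - x ^ 2 := by
    have := (sq_le_one_iff_abs_le_one x).mpr hx
    linarith
  have hsq : ((√(1 - x ^ 2) : ℝ) : ℂ) ^ 2 = 1 - (x : ℂ) ^ 2 := by
    rw [← Complex.ofReal_pow, Real.sq_sqrt hx2]
    push_cast
    ring
  set y : ℝ := √(1 - x ^ 2)
  have hy : y ^ 2 = 1 - x ^ 2 := Real.sq_sqrt hx2
  have hz : ∀ s : ℝ, s ^ 2 = 1 - x ^ 2 → ‖(x : ℂ) + s * Complex.I‖ ≤ 1 := by
    intro s hs
    rw [Complex.norm_add_mul_I, hs]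
    simp
  have h := qHermite_eq_S2 (q := (q : ℂ)) (x := (x : ℂ)) (z := x + y * Complex.I)
    (w := x + (-y : ℝ) * Complex.I) (by simpa using hq) (by push_cast; ring)
    (by push_cast; linear_combination (-(y : ℂ) ^ 2) * Complex.I_sq + hsq) n
  have h2 := qHermite_ofReal (𝕜 := ℂ) q x n
  have h3 := hM' 1 _ _ (hz y hy) (hz (-y) (by rw [neg_sq, hy])) n
  rw [← h] at h3
  rw [qHermite_ofReal, RCLike.norm_ofReal]
  rw [one_pow, mul_one] at h3
  have h4 : ‖qHermite (q : ℂ) (x : ℂ) n‖ = |qHermite q x n| := by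
    rw [← RCLike.norm_ofReal (K := ℂ), ← h2]
    rfl
  rwa [h4] at h3

lemma summable_add_one_pow_mul_geometric {r : ℝ} (hr0 : 0 < r) (hr : r < 1) (k : ℕ) :
    Summable fun n : ℕ => r ^ n * ((n : ℝ) + 1) ^ k := by
  have h := (summable_nat_add_iff 1).mpr
    (summable_pow_mul_geometric_of_norm_lt_one k (r := r) (by rwa [Real.norm_of_nonneg hr0.le]))
  refine (h.mul_left r⁻¹).congr fun n => ?_
  push_cast
  rw [pow_succ' r]
  field_simp

/-- The series `∑ₙ σₙ(a,b,c,d|q) hₙ(x|q) / (q)ₙ`. -/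
noncomputable def sigmaSeries (q x : ℝ) (a b c d : 𝕜) : 𝕜 :=
  ∑' n : ℕ, sigma4 (q : 𝕜) n a b c d / qPoch (q : 𝕜) (q : 𝕜) n * qHermite (q : 𝕜) (x : 𝕜) n

/-- A single summable majorant serves all `x ∈ [-1, 1]`, all parameters in a polydisc, and both
`∑ σₙ hₙ / (q)ₙ` and `∑ σₙ hₙ₊₁ / (q)ₙ`. -/
lemma exists_summable_bound (𝕜 : Type*) [RCLike 𝕜] (hq : |q| < 1) {r : ℝ} (hr0 : 0 < r)
    (hr : r < 1) :
    ∃ u : ℕ → ℝ, Summable u ∧ ∀ a b c d : 𝕜, ‖a‖ ≤ r → ‖b‖ ≤ r → ‖c‖ ≤ r → ‖d‖ ≤ r →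
      ∀ x : ℝ, |x| ≤ 1 → ∀ n : ℕ,
        ‖sigma4 (q : 𝕜) n a b c d / qPoch (q : 𝕜) (q : 𝕜) n * qHermite (q : 𝕜) (x : 𝕜) n‖ ≤ u n ∧
        ‖sigma4 (q : 𝕜) n a b c d / qPoch (q : 𝕜) (q : 𝕜) n *
          qHermite (q : 𝕜) (x : 𝕜) (n + 1)‖ ≤ u n := by
  obtain ⟨A, hA, hA'⟩ := exists_norm_sigma4_div_le (norm_ofReal_lt_one (𝕜 := 𝕜) hq) hr0.le hr
  obtain ⟨B, hB, hB'⟩ := exists_norm_qHermite_le 𝕜 hq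
  refine ⟨fun n => 2 * A * B * (r ^ n * ((n : ℝ) + 1) ^ 4),
    (summable_add_one_pow_mul_geometric hr0 hr 4).mul_left _, fun a b c d ha hb hc hd x hx n => ?_⟩
  have h1 := hA' a b c d ha hb hc hd n
  have key : ∀ y : 𝕜, ‖y‖ ≤ B * (2 * ((n : ℝ) + 1)) →
      ‖sigma4 (q : 𝕜) n a b c d / qPoch (q : 𝕜) (q : 𝕜) n * y‖ ≤
        2 * A * B * (r ^ n * ((n : ℝ) + 1) ^ 4) := by
    intro y hy
    rw [norm_mul]
    calc _ ≤ A * r ^ n * ((n : ℝ) + 1) ^ 3 * (B * (2 * ((n : ℝ) + 1))) := by gcongr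
      _ = _ := by ring
  have hn : (0 : ℝ) ≤ n := Nat.cast_nonneg n
  refine ⟨key _ ((hB' x hx n).trans ?_), key _ ((hB' x hx (n + 1)).trans ?_)⟩
  · gcongr
    linarith
  · push_cast
    gcongr
    linarith

lemma exists_radius {a b c d : 𝕜} (ha : ‖a‖ < 1) (hb : ‖b‖ < 1) (hc : ‖c‖ < 1) (hd : ‖d‖ < 1) :
    ∃ r : ℝ, 0 < r ∧ r < 1 ∧ ‖a‖ ≤ r ∧ ‖b‖ ≤ r ∧ ‖c‖ ≤ r ∧ ‖d‖ ≤ r := by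
  refine ⟨max (1 / 2) (max (max ‖a‖ ‖b‖) (max ‖c‖ ‖d‖)), ?_, ?_, ?_, ?_, ?_, ?_⟩
  · exact lt_max_of_lt_left (by norm_num)
  · simp only [max_lt_iff]
    exact ⟨by norm_num, ⟨ha, hb⟩, hc, hd⟩
  all_goals simp

/-! ### The functional equation and its iteration -/

/-- Multiplication of `∑ sₙ Hₙ` by `1 - 2 x a + a²`, on the level of the coefficients. -/
lemma hasSum_of_recurrence {q x a κ e A A' B : 𝕜} {s s' H : ℕ → 𝕜}
    (hH : ∀ n, H (n + 1) = 2 * x * H n - (1 - q ^ n) * H (n - 1))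
    (hA : HasSum (fun n => s n * H n) A) (hA' : HasSum (fun n => s' n * H n) A')
    (hB : HasSum (fun n => s n * H (n + 1)) B)
    (h0 : κ * s' 0 = e * ((1 + a ^ 2) * s 0 - a * ((1 - q ^ 1) * s 1)))
    (hs : ∀ n, κ * s' (n + 1) =
      e * ((1 + a ^ 2) * s (n + 1) - a * ((1 - q ^ (n + 2)) * s (n + 2)) - a * s n)) :
    κ * A' = (1 - 2 * x * a + a ^ 2) * e * A := by
  have hH0 : H 1 = 2 * x * H 0 := by simpa using hH 0
  have hup : HasSum (fun n => (1 - q ^ (n + 1)) * s (n + 1) * H n) (2 * x * A - B) := by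
    have h1 := ((hasSum_nat_add_iff' 1).mpr hA).mul_left (2 * x)
    have h2 := h1.sub ((hasSum_nat_add_iff' 1).mpr hB)
    have hval : 2 * x * (A - ∑ i ∈ range 1, s i * H i) - (B - ∑ i ∈ range 1, s i * H (i + 1)) =
        2 * x * A - B := by
      rw [sum_range_one, sum_range_one, zero_add, hH0]
      ring
    rw [hval] at h2
    have heq : (fun n => (1 - q ^ (n + 1)) * s (n + 1) * H n) =
        fun n => 2 * x * (s (n + 1) * H (n + 1)) - s (n + 1) * H (n + 1 + 1) := by
      funext n
      rw [hH (n + 1), Nat.add_sub_cancel]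
      ring
    rwa [heq]
  have h1 := (hasSum_nat_add_iff' 1).mpr (hA'.mul_left κ)
  have h2 := (((hasSum_nat_add_iff' 1).mpr
    ((hA.mul_left (1 + a ^ 2)).sub (hup.mul_left a))).sub (hB.mul_left a)).mul_left e
  have heq : (fun n => κ * (s' (n + 1) * H (n + 1))) = fun n => e * ((1 + a ^ 2) *
      (s (n + 1) * H (n + 1)) - a * ((1 - q ^ (n + 1 + 1)) * s (n + 1 + 1) * H (n + 1)) -
        a * (s n * H (n + 1))) := by
    funext n
    linear_combination H (n + 1) * hs n
  rw [heq] at h1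
  have h3 := h1.unique h2
  rw [sum_range_one, sum_range_one, zero_add] at h3
  linear_combination h3 + H 0 * h0

/-- The `q`-difference equation in `a`, obtained by summing `sigma4_contiguous_a` against the
three-term recurrence of the `q`-Hermite polynomials. -/
lemma sigmaSeries_shift (hq : |q| < 1) {x : ℝ} (hx : |x| ≤ 1) {a b c d : 𝕜}
    (ha : ‖a‖ < 1) (hb : ‖b‖ < 1) (hc : ‖c‖ < 1) (hd : ‖d‖ < 1) :
    (1 - a * b) * (1 - a * c) * (1 - a * d) * sigmaSeries q x ((q : 𝕜) * a) b c d =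
      (1 - 2 * (x : 𝕜) * a + a ^ 2) * (1 - a * b * c * d) * sigmaSeries q x a b c d := by
  have hq' : ‖(q : 𝕜)‖ < 1 := norm_ofReal_lt_one hq
  obtain ⟨r, hr0, hr, ha', hb', hc', hd'⟩ := exists_radius ha hb hc hd
  obtain ⟨u, hu, hu'⟩ := exists_summable_bound 𝕜 hq hr0 hr
  have hqa : ‖(q : 𝕜) * a‖ ≤ r := by
    rw [norm_mul]
    exact (mul_le_of_le_one_left (norm_nonneg _) hq'.le).trans ha'
  have hA := (Summable.of_norm_bounded hu fun n => (hu' a b c d ha' hb' hc' hd' x hx n).1).hasSum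
  have hB := (Summable.of_norm_bounded hu fun n => (hu' a b c d ha' hb' hc' hd' x hx n).2).hasSum
  have hA' :=
    (Summable.of_norm_bounded hu fun n => (hu' _ b c d hqa hb' hc' hd' x hx n).1).hasSum
  have hcont := sigma4_contiguous_a hq' (norm_mul4_lt_one ha hb hc hd)
  have hP := qPoch_ne_zero hq' hq'
  have hQ := one_sub_pow_succ_ne_zero hq'
  refine hasSum_of_recurrence (s := fun n => sigma4 (q : 𝕜) n a b c d / qPoch (q : 𝕜) q n)
    (s' := fun n => sigma4 (q : 𝕜) n (q * a) b c d / qPoch (q : 𝕜) q n)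
    (H := qHermite (q : 𝕜) x) (qHermite_succ _ _) hA hA' hB ?_ fun n => ?_
  · have h := hcont 0
    have h1 := hQ 0
    simp only [qPoch_self_succ, qPoch_zero, pow_zero, sub_self, zero_mul, mul_zero, sub_zero,
      zero_add, div_one, one_mul] at h h1 ⊢
    rw [mul_div_cancel₀ _ h1]
    exact h
  · have h := hcont (n + 1)
    have h1 := hQ n
    have h2 := hQ (n + 1)
    have h3 := hP n
    simp only [qPoch_self_succ, Nat.add_sub_cancel] at h ⊢
    generalize sigma4 (q : 𝕜) (n + 1) (q * a) b c d = S at h ⊢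
    field_simp
    linear_combination h

lemma continuous_qPoch (q : 𝕜) (n : ℕ) : Continuous fun a => qPoch q a n := by
  unfold qPoch
  fun_prop

lemma continuousAt_sigma4 (q : 𝕜) (n : ℕ) (b c d : 𝕜) :
    ContinuousAt (fun a => sigma4 q n a b c d) 0 := by
  have h1 : ∀ j, ContinuousAt (fun a : 𝕜 => qPoch q (a * b * c * d) j) 0 := fun j =>
    ((continuous_qPoch q j).comp (by fun_prop : Continuous fun a : 𝕜 => a * b * c * d)).continuousAt
  have h2 : ∀ j, ContinuousAt (fun a : 𝕜 => qPoch q (a * d) j) 0 := fun j =>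
    ((continuous_qPoch q j).comp (by fun_prop : Continuous fun a : 𝕜 => a * d)).continuousAt
  have h3 : ∀ j, qPoch q (0 * b * c * d) j ≠ 0 := fun j => by simp
  unfold sigma4
  fun_prop (disch := exact h3 _)

/-- Dominated convergence for the dilations `a ↦ qᵏ a`. -/
lemma tendsto_sigmaSeries (hq : |q| < 1) {x : ℝ} (hx : |x| ≤ 1) {a b c d : 𝕜}
    (ha : ‖a‖ < 1) (hb : ‖b‖ < 1) (hc : ‖c‖ < 1) (hd : ‖d‖ < 1) :
    Tendsto (fun k : ℕ => sigmaSeries q x ((q : 𝕜) ^ k * a) b c d) atTop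
      (𝓝 (sigmaSeries q x 0 b c d)) := by
  have hq' : ‖(q : 𝕜)‖ < 1 := norm_ofReal_lt_one hq
  obtain ⟨r, hr0, hr, ha', hb', hc', hd'⟩ := exists_radius ha hb hc hd
  obtain ⟨u, hu, hu'⟩ := exists_summable_bound 𝕜 hq hr0 hr
  refine tendsto_tsum_of_dominated_convergence hu (fun n => ?_) (Eventually.of_forall fun k n => ?_)
  · have h0 : Tendsto (fun k : ℕ => (q : 𝕜) ^ k * a) atTop (𝓝 0) := by
      simpa using (tendsto_pow_atTop_nhds_zero_of_norm_lt_one hq').mul_const a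
    exact (((continuousAt_sigma4 (q : 𝕜) n b c d).tendsto.comp h0).div_const _).mul_const _
  · refine (hu' _ b c d ?_ hb' hc' hd' x hx n).1
    rw [norm_mul, norm_pow]
    exact (mul_le_of_le_one_left (norm_nonneg _) (pow_le_one₀ (norm_nonneg _) hq'.le)).trans ha'

lemma tendsto_qPoch (hq : |q| < 1) (p : 𝕜) :
    Tendsto (qPoch (q : 𝕜) p) atTop (𝓝 (qPochInf (q : 𝕜) p)) := by
  have h : Summable fun j : ℕ => ‖-(p * (q : 𝕜) ^ j)‖ := by
    simp only [norm_neg, norm_mul, norm_pow]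
    exact (summable_geometric_of_lt_one (norm_nonneg _) (norm_ofReal_lt_one hq)).mul_left _
  have := (multipliable_one_add_of_summable h).hasProd.tendsto_prod_nat
  simp only [← sub_eq_add_neg] at this
  exact this

lemma qPochInf_ne_zero (hq : |q| < 1) {p : 𝕜} (hp : ‖p‖ < 1) : qPochInf (q : 𝕜) p ≠ 0 := by
  obtain ⟨M, hM, hM'⟩ :=
    exists_norm_inv_qPoch_le (norm_ofReal_lt_one (𝕜 := 𝕜) hq) (norm_nonneg p) hp
  have h : M⁻¹ ≤ ‖qPochInf (q : 𝕜) p‖ := by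
    refine ge_of_tendsto (tendsto_qPoch hq p).norm (Eventually.of_forall fun n => ?_)
    have h1 := hM' p le_rfl n
    rw [norm_inv] at h1
    have h2 := norm_pos_iff.mpr (qPoch_ne_zero (norm_ofReal_lt_one (𝕜 := 𝕜) hq) hp n)
    exact (inv_le_comm₀ h2 hM).mp h1
  exact norm_pos_iff.mp ((inv_pos.mpr hM).trans_le h)

lemma qPochInf_zero (q : ℝ) : qPochInf (q : 𝕜) (0 : 𝕜) = 1 := by
  simp [qPochInf]

lemma sigma4_zero_zero_zero (hq : ‖(q : 𝕜)‖ < 1) (n : ℕ) (a : 𝕜) :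
    sigma4 (q : 𝕜) n a 0 0 0 = a ^ n := by
  have h0 : qGen (q : 𝕜) (fun n => (0 : 𝕜) ^ n) = 1 := by
    ext n
    rw [coeff_qGen, PowerSeries.coeff_one]
    split_ifs with h <;> simp [h]
  have h := qGen_sigma4 hq a 0 0 0
  have hw : (fun n => weightedSum (q : 𝕜) n a 0 0 0) = fun n => innerSum (q : 𝕜) n a 0 0 0 := by
    funext n
    simp [weightedSum]
  rw [qGen_S2 hq, hw, qGen_innerSum hq] at h
  simp only [mul_zero, qPoch_zero_right, one_mul, h0, mul_one] at h
  have hn := congrArg (PowerSeries.coeff n) h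
  rw [coeff_qGen, coeff_qGen] at hn
  exact (div_left_inj' (qPoch_ne_zero hq hq n)).mp hn

lemma sigmaSeries_zero_zero_zero (hq : |q| < 1) (x : ℝ) (a : 𝕜) :
    sigmaSeries q x a 0 0 0 = phiH (q : 𝕜) (x : 𝕜) a := by
  simp only [sigmaSeries, phiH, sigma4_zero_zero_zero (norm_ofReal_lt_one hq)]

lemma phiH_zero (q x : ℝ) : phiH (q : 𝕜) (x : 𝕜) 0 = 1 := by
  rw [phiH, tsum_eq_single 0 fun n hn => by simp [hn]]
  simp [qHermite]

/-- `φ_h(x|a,q)` satisfies the equation `sigmaSeries_shift` with `b = c = d = 0`; comparing the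
two after `k` steps cancels the factors `1 - 2 x a qʲ + a² q²ʲ`. -/
lemma qPoch_mul_sigmaSeries (hq : |q| < 1) {x : ℝ} (hx : |x| ≤ 1) {a b c d : 𝕜}
    (ha : ‖a‖ < 1) (hb : ‖b‖ < 1) (hc : ‖c‖ < 1) (hd : ‖d‖ < 1) (k : ℕ) :
    qPoch (q : 𝕜) (a * b) k * qPoch (q : 𝕜) (a * c) k * qPoch (q : 𝕜) (a * d) k *
        sigmaSeries q x ((q : 𝕜) ^ k * a) b c d * phiH (q : 𝕜) (x : 𝕜) a =
      qPoch (q : 𝕜) (a * b * c * d) k * sigmaSeries q x a b c d *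
        phiH (q : 𝕜) (x : 𝕜) ((q : 𝕜) ^ k * a) := by
  induction k with
  | zero => simp only [qPoch_zero, pow_zero, one_mul]
  | succ k ih =>
    have hq' : ‖(q : 𝕜)‖ < 1 := norm_ofReal_lt_one hq
    have hk : ‖(q : 𝕜) ^ k * a‖ < 1 := by
      rw [norm_mul, norm_pow]
      exact (mul_le_of_le_one_left (norm_nonneg _) (pow_le_one₀ (norm_nonneg _) hq'.le)).trans_lt ha
    have h0 : ‖(0 : 𝕜)‖ < 1 := by simp
    have h1 := sigmaSeries_shift hq hx hk hb hc hd
    have h2 := sigmaSeries_shift hq hx hk h0 h0 h0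
    simp only [sigmaSeries_zero_zero_zero hq, mul_zero, sub_zero, one_mul, mul_one] at h2
    rw [← mul_assoc, ← pow_succ'] at h1 h2
    rw [qPoch_succ, qPoch_succ, qPoch_succ, qPoch_succ, h2]
    generalize sigmaSeries q x ((q : 𝕜) ^ (k + 1) * a) b c d = T at h1 ⊢
    generalize sigmaSeries q x ((q : 𝕜) ^ k * a) b c d = T' at h1 ih ⊢
    generalize phiH (q : 𝕜) (x : 𝕜) ((q : 𝕜) ^ k * a) = P at ih ⊢
    linear_combination
      qPoch (q : 𝕜) (a * b) k * qPoch (q : 𝕜) (a * c) k * qPoch (q : 𝕜) (a * d) k *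
        phiH (q : 𝕜) (x : 𝕜) a * h1 +
      (1 - 2 * (x : 𝕜) * ((q : 𝕜) ^ k * a) + ((q : 𝕜) ^ k * a) ^ 2) *
        (1 - a * b * c * d * (q : 𝕜) ^ k) * ih

/-- One parameter of the series can be split off as a factor `φ_h(x|a,q)`. -/
lemma sigmaSeries_eq_mul_phiH (hq : |q| < 1) {x : ℝ} (hx : |x| ≤ 1) {a b c d : 𝕜}
    (ha : ‖a‖ < 1) (hb : ‖b‖ < 1) (hc : ‖c‖ < 1) (hd : ‖d‖ < 1) :
    qPochInf (q : 𝕜) (a * b * c * d) * sigmaSeries q x a b c d =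
      qPochInf (q : 𝕜) (a * b) * qPochInf (q : 𝕜) (a * c) * qPochInf (q : 𝕜) (a * d) *
        sigmaSeries q x 0 b c d * phiH (q : 𝕜) (x : 𝕜) a := by
  have h0 : ‖(0 : 𝕜)‖ < 1 := by simp
  have hphi := tendsto_sigmaSeries hq hx ha h0 h0 h0
  simp only [sigmaSeries_zero_zero_zero hq, phiH_zero q] at hphi
  have h1 := ((tendsto_qPoch hq (a * b * c * d)).mul_const (sigmaSeries q x a b c d)).mul hphi
  have h2 := ((((tendsto_qPoch hq (a * b)).mul (tendsto_qPoch hq (a * c))).mul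
    (tendsto_qPoch hq (a * d))).mul (tendsto_sigmaSeries hq hx ha hb hc hd)).mul_const
      (phiH (q : 𝕜) (x : 𝕜) a)
  simp only [qPoch_mul_sigmaSeries hq hx ha hb hc hd] at h2
  rw [← tendsto_nhds_unique h1 h2, mul_one]

lemma sigmaSeries_swap_ab (hq : |q| < 1) (x : ℝ) {a b c d : 𝕜}
    (ha : ‖a‖ < 1) (hb : ‖b‖ < 1) (hc : ‖c‖ < 1) (hd : ‖d‖ < 1) :
    sigmaSeries q x a b c d = sigmaSeries q x b a c d := by
  simp only [sigmaSeries, sigma4_swap_ab (norm_ofReal_lt_one hq) hc hd _ a b ha hb]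

lemma sigmaSeries_swap_ac (hq : |q| < 1) (x : ℝ) (a b c d : 𝕜) :
    sigmaSeries q x a b c d = sigmaSeries q x c b a d := by
  simp only [sigmaSeries, sigma4_swap_ac (norm_ofReal_lt_one hq) _ a b c d]

lemma sigmaSeries_swap_bd (hq : |q| < 1) (x : ℝ) (a b c d : 𝕜) :
    sigmaSeries q x a b c d = sigmaSeries q x a d c b := by
  simp only [sigmaSeries, sigma4_swap_bd (norm_ofReal_lt_one hq) _ a b c d]

/-- Splitting off the parameters one after the other. -/
lemma sigmaSeries_eq (hq : |q| < 1) {x : ℝ} (hx : |x| ≤ 1) {a b c d : 𝕜}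
    (ha : ‖a‖ < 1) (hb : ‖b‖ < 1) (hc : ‖c‖ < 1) (hd : ‖d‖ < 1) :
    qPochInf (q : 𝕜) (a * b * c * d) * sigmaSeries q x a b c d =
      qPochInf (q : 𝕜) (a * b) * qPochInf (q : 𝕜) (a * c) * qPochInf (q : 𝕜) (a * d) *
        qPochInf (q : 𝕜) (b * c) * qPochInf (q : 𝕜) (b * d) * qPochInf (q : 𝕜) (c * d) *
        phiH (q : 𝕜) (x : 𝕜) a * phiH (q : 𝕜) (x : 𝕜) b *
        phiH (q : 𝕜) (x : 𝕜) c * phiH (q : 𝕜) (x : 𝕜) d := by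
  have h0 : ‖(0 : 𝕜)‖ < 1 := by simp
  have h1 := sigmaSeries_eq_mul_phiH hq hx ha hb hc hd
  have h2 := sigmaSeries_eq_mul_phiH hq hx hb h0 hc hd
  have h3 := sigmaSeries_eq_mul_phiH hq hx hc h0 h0 hd
  rw [sigmaSeries_swap_ab hq x hb h0 hc hd] at h2
  rw [sigmaSeries_swap_ac hq x c 0 0 d, sigmaSeries_swap_bd hq x 0 0 0 d,
    sigmaSeries_swap_ab hq x h0 hd h0 h0, sigmaSeries_zero_zero_zero hq] at h3
  simp only [mul_zero, zero_mul, qPochInf_zero q, one_mul] at h2 h3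
  rw [h1, h2, h3]
  ring

end Series

end AskeyWilson

/-! ### The expansion of the Askey–Wilson density -/

theorem theorem1 {𝕜 : Type*} [RCLike 𝕜] (q : ℝ) (hq : |q| < 1)
    (a b c d : 𝕜) (ha : ‖a‖ < 1) (hb : ‖b‖ < 1) (hc : ‖c‖ < 1) (hd : ‖d‖ < 1) :
    (∀ x : ℝ, |x| ≤ 1 →
      Summable (fun n : ℕ =>
        AskeyWilson.sigma4 (q : 𝕜) n a b c d / AskeyWilson.qPoch (q : 𝕜) (q : 𝕜) n *
          AskeyWilson.qHermite (q : 𝕜) (x : 𝕜) n) ∧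
      AskeyWilson.fAW q x a b c d =
        (AskeyWilson.fH q x : 𝕜) * ∑' n : ℕ,
          AskeyWilson.sigma4 (q : 𝕜) n a b c d / AskeyWilson.qPoch (q : 𝕜) (q : 𝕜) n *
            AskeyWilson.qHermite (q : 𝕜) (x : 𝕜) n) ∧
    TendstoUniformlyOn
      (fun (N : ℕ) (x : ℝ) => ∑ n ∈ Finset.range N,
        AskeyWilson.sigma4 (q : 𝕜) n a b c d / AskeyWilson.qPoch (q : 𝕜) (q : 𝕜) n *
          AskeyWilson.qHermite (q : 𝕜) (x : 𝕜) n)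
      (fun x : ℝ => ∑' n : ℕ,
        AskeyWilson.sigma4 (q : 𝕜) n a b c d / AskeyWilson.qPoch (q : 𝕜) (q : 𝕜) n *
          AskeyWilson.qHermite (q : 𝕜) (x : 𝕜) n)
      Filter.atTop (Set.Icc (-1 : ℝ) 1) ∧
    ∀ (n : ℕ) (τ : Equiv.Perm (Fin 4)),
      AskeyWilson.sigma4 (q : 𝕜) n
          (![a, b, c, d] (τ 0)) (![a, b, c, d] (τ 1))
          (![a, b, c, d] (τ 2)) (![a, b, c, d] (τ 3)) =
        AskeyWilson.sigma4 (q : 𝕜) n a b c d := by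
  have hq' : ‖(q : 𝕜)‖ < 1 := AskeyWilson.norm_ofReal_lt_one hq
  obtain ⟨r, hr0, hr, ha', hb', hc', hd'⟩ := AskeyWilson.exists_radius ha hb hc hd
  obtain ⟨u, hu, hu'⟩ := AskeyWilson.exists_summable_bound 𝕜 hq hr0 hr
  have hbound := fun x hx n => (hu' a b c d ha' hb' hc' hd' x hx n).1
  refine ⟨fun x hx => ⟨Summable.of_norm_bounded hu (hbound x hx), ?_⟩, ?_, fun n τ => ?_⟩
  · have h := AskeyWilson.sigmaSeries_eq hq hx ha hb hc hd
    have he := AskeyWilson.qPochInf_ne_zero hq (AskeyWilson.norm_mul4_lt_one ha hb hc hd)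
    rw [← AskeyWilson.sigmaSeries, AskeyWilson.fAW, eq_div_of_mul_eq he ((mul_comm _ _).trans h)]
    ring
  · exact tendstoUniformlyOn_tsum_nat hu fun n x hx => hbound x (abs_le.mpr hx) n
  · refine AskeyWilson.sigma4_perm hq' n τ ![a, b, c, d] fun i => ?_
    fin_cases i
    exacts [ha, hb, hc, hd]
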